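/- Let $\mathbb{K}$ be a field, $V=\{1<\dots<n\}$ a finite vertex set, and $\Delta$ a $d$-dimensional simplicial complex on $V$ (the empty set is a face, and $d=\max\{|\sigma|-1:\sigma\in\Delta\}$; not every element of $V$ has to be a vertex of $\Delta$). Let $R=\mathbb{K}[x_1,\dots,x_n]$ act on $S=\mathbb{K}[y_1,\dots,y_n]$ by contraction: $x^a\circ y^b=y^{b-a}$ if $b_i\ge a_i$ for all $i$, and $x^a\circ y^b=0$ otherwise, extended bilinearly. Let $I_\Delta=(\prod_{i\in\tau}x_i:\tau\subseteq V,\ \tau\notin\Delta)$ be the Stanley–Reisner ideal and $e_i$ the $i$-th elementary symmetric polynomial in $x_1,\dots,x_n$. For $k\ge 0$ let the space of $k$-coinvariant stresses be $$\mathcal{S}^{\mathrm{co}}_k(\Delta)=\{F\in S:\ F \text{ homogeneous of degree } k \text{ in the } y_i,\ g\circ F=0 \text{ for all } g\in(I_\Delta,e_1,\dots,e_{d+1})\}.$$ Put $t=\binom{d+2}{2}$. Then $$\dim_{\mathbb{K}}\mathcal{S}^{\mathrm{co}}_t(\Delta)\ \ge\ \dim_{\mathbb{K}}\tilde H_d(\Delta;\mathbb{K}),$$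 where $\tilde H_d$ denotes reduced simplicial homology. Moreover, if $\mathbb{K}$ has characteristic zero and $\Delta$ is Cohen–Macaulay over $\mathbb{K}$ (that is, $R/I_\Delta$ is a Cohen–Macaulay ring), then equality holds: $$\dim_{\mathbb{K}}\mathcal{S}^{\mathrm{co}}_t(\Delta)=\dim_{\mathbb{K}}\tilde H_d(\Delta;\mathbb{K}).$$ -/

import Mathlib

/-- A commutative ring `A` is Cohen–Macaulay if it is Noetherian and, for every maximal ideal `m`,
the local ring `A_m` has depth equal to its Krull dimension, i.e. its maximal ideal contains an
`A_m`-regular sequence whose length is `dim A_m` (no regular sequence can be longer). -/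
def IsCohenMacaulayRing (A : Type*) [CommRing A] : Prop :=
  IsNoetherianRing A ∧
    ∀ (m : Ideal A) [m.IsMaximal], ∃ rs : List (Localization.AtPrime m),
      (∀ r ∈ rs, r ∈ IsLocalRing.maximalIdeal (Localization.AtPrime m)) ∧
      RingTheory.Sequence.IsRegular (Localization.AtPrime m) rs ∧
      ((rs.length : ℕ∞) : WithBot ℕ∞) = ringKrullDim (Localization.AtPrime m)

section InverseSystems

variable (K V : Type*) [Field K]

/-- The contraction action of `R = K[x_v : v ∈ V]` on `S = K[y_v : v ∈ V]` (a second copy of the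
same polynomial ring): `x^a ∘ y^b = y^(b - a)` if `a ≤ b` coordinatewise and `x^a ∘ y^b = 0`
otherwise, extended bilinearly. -/
noncomputable def contraction :
    MvPolynomial V K →ₗ[K] MvPolynomial V K →ₗ[K] MvPolynomial V K := by
  classical
  exact (MvPolynomial.basisMonomials V K).constr K fun a =>
    (MvPolynomial.basisMonomials V K).constr K fun b =>
      if a ≤ b then MvPolynomial.monomial (b - a) (1 : K) else 0

variable {K V}

/-- The inverse system `I⁻¹ = {F ∈ S : g ∘ F = 0 for every g ∈ I}`, as a `K`-vector space. -/
noncomputable def inverseSystem (I : Ideal (MvPolynomial V K)) :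
    Submodule K (MvPolynomial V K) where
  carrier := {F | ∀ g ∈ I, contraction K V g F = 0}
  add_mem' := by
    intro F G hF hG g hg
    rw [map_add, hF g hg, hG g hg, add_zero]
  zero_mem' := by
    intro g _
    exact map_zero _
  smul_mem' := by
    intro c F hF g hg
    rw [map_smul, hF g hg, smul_zero]

/-- The component `(I⁻¹)_{-k}`. Since `deg y_v = -1`, it consists of the elements of `I⁻¹` that
are homogeneous polynomials of ordinary degree `k`. -/
noncomputable def inverseSystemDegree (I : Ideal (MvPolynomial V K)) (k : ℕ) :
    Submodule K (MvPolynomial V K) :=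
  inverseSystem I ⊓ MvPolynomial.homogeneousSubmodule V K k

end InverseSystems

namespace PreAbstractSimplicialComplex

/-- The faces of a simplicial complex, the empty face included. (Mathlib's `Δ.faces` lists the
nonempty ones.) -/
def IsFace {V : Type*} (Δ : PreAbstractSimplicialComplex V) (σ : Finset V) : Prop :=
  σ = ∅ ∨ σ ∈ Δ.faces

open Classical in
/-- `dim Δ`: the maximum of `|σ| - 1` over the faces `σ`; it is `-1` for the complex `{∅}`. -/
noncomputable def dim {V : Type*} [Fintype V] (Δ : PreAbstractSimplicialComplex V) : ℤ :=
  (((Finset.univ.filter fun σ : Finset V => Δ.IsFace σ).sup Finset.card : ℕ) : ℤ) - 1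

section Homology

variable (K : Type*) [Field K] {V : Type*} [Fintype V] [LinearOrder V]

/-- The simplicial boundary map
`∂ {v_0 < ⋯ < v_i} = ∑ j, (-1)^j {v_0, …, v_i} \ {v_j}` on the vector space `Finset V → K` with
basis (`Pi.single σ 1`) all subsets `σ` of `V`. Here `j` is the number of elements of the set
below `v_j`. In particular `∂ {v} = ∅` (the augmentation) and `∂ ∅ = 0`. -/
noncomputable def boundary : (Finset V → K) →ₗ[K] (Finset V → K) :=
  Fintype.linearCombination K fun σ : Finset V =>
    ∑ v ∈ σ, Pi.single (σ.erase v) ((-1 : K) ^ (σ.filter (· < v)).card)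

/-- The chain group `C_i(Δ; K)`, with basis the `i`-dimensional faces; `C_{-1}` is spanned
by `∅`. -/
def chains (Δ : PreAbstractSimplicialComplex V) (i : ℤ) : Submodule K (Finset V → K) where
  carrier := {c | ∀ σ : Finset V, c σ ≠ 0 → Δ.IsFace σ ∧ (σ.card : ℤ) - 1 = i}
  add_mem' := by
    intro a b ha hb σ h
    by_cases h0 : a σ = 0
    · exact hb σ fun h1 => h (by simp [h0, h1])
    · exact ha σ h0
  zero_mem' := by
    intro σ h
    exact absurd rfl h
  smul_mem' := by
    intro c a ha σ h
    exact ha σ fun h0 => h (by simp [h0])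

/-- The reduced cycles of dimension `i`. -/
noncomputable def cycles (Δ : PreAbstractSimplicialComplex V) (i : ℤ) :
    Submodule K (Finset V → K) :=
  Δ.chains K i ⊓ LinearMap.ker (boundary K)

/-- The boundaries of dimension `i`. -/
noncomputable def boundaries (Δ : PreAbstractSimplicialComplex V) (i : ℤ) :
    Submodule K (Finset V → K) :=
  (Δ.chains K (i + 1)).map (boundary K)

/-- The reduced simplicial homology `H̃_i(Δ; K)`: cycles modulo boundaries. -/
abbrev reducedHomology (Δ : PreAbstractSimplicialComplex V) (i : ℤ) : Type _ :=
  Δ.cycles K i ⧸ (Δ.boundaries K i).submoduleOf (Δ.cycles K i)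

end Homology

section StanleyReisner

variable (K : Type*) [Field K] {V : Type*}

/-- The Stanley–Reisner ideal `I_Δ = (∏_{v ∈ τ} x_v : τ ∉ Δ)`. -/
noncomputable def stanleyReisnerIdeal (Δ : PreAbstractSimplicialComplex V) : Ideal (MvPolynomial V K) :=
  Ideal.span {p | ∃ τ : Finset V, ¬ Δ.IsFace τ ∧ p = ∏ v ∈ τ, MvPolynomial.X v}

/-- `Δ` is Cohen–Macaulay over `K` if its Stanley–Reisner ring `R / I_Δ` is Cohen–Macaulay. -/
def IsCohenMacaulay (Δ : PreAbstractSimplicialComplex V) : Prop :=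
  IsCohenMacaulayRing (MvPolynomial V K ⧸ Δ.stanleyReisnerIdeal K)

variable [Fintype V]

/-- The ideal `(I_Δ, e_1, …, e_{d+1})`, where `d = dim Δ` and `e_i` is the `i`-th elementary
symmetric polynomial in all the variables. -/
noncomputable def coinvariantIdeal (Δ : PreAbstractSimplicialComplex V) :
    Ideal (MvPolynomial V K) :=
  Δ.stanleyReisnerIdeal K ⊔
    Ideal.span {p | ∃ i : ℕ, 1 ≤ i ∧ (i : ℤ) ≤ Δ.dim + 1 ∧ p = MvPolynomial.esymm V K i}

/-- The space `S^co_k(Δ) = (I_Δ, e_1, …, e_{d+1})⁻¹_{-k}` of `k`-coinvariant stresses. -/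
noncomputable def coinvariantStresses (Δ : PreAbstractSimplicialComplex V) (k : ℕ) :
    Submodule K (MvPolynomial V K) :=
  inverseSystemDegree (Δ.coinvariantIdeal K) k

end StanleyReisner

end PreAbstractSimplicialComplex

/-! Write D = d + 1 for the largest size of a face, so that t = binom(D + 1, 2). The stresses of
degree t are isomorphic to the d-cycles, and these are the top homology because there are no chains
of dimension d + 1.

A chain c yields the form F_c = ∑ c(w) ∏ y_{w j}^{j+1} over the orderings w of D-element sets, where
c(w) is the value of c with the sign of w. Contraction by e_k lowers k of the exponents 1, …, D by
one. If the exponent 1 is not lowered, two exponents become equal and the alternating signs cancel;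
if it is lowered, the first vertex drops out and summing over it produces ∂c. Hence cycles give
stresses (`contraction_esymm_stressOfChain_of_cycle`).

Conversely, the coinvariant algebra in n variables ends in degree binom(n, 2), where a staircase
monomial spans it (`functional_eq_zero`). Applied face by face, from large supports to small, this
shows that a stress is determined by its staircase coefficients on the faces of size D
(`coinvariantStress_eq_zero`). Comparison with F_c shows that these coefficients alternate
(`coeff_staircase_eq`), and then e_D ∘ F = 0 says that they form a cycle
(`chainOfStress_mem_cycles`). -/

open MvPolynomial Finset

/-! ### Contraction as a module action, and the pairing it induces. -/

section Contraction

variable {K V : Type*} [Field K]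

theorem contraction_monomial_monomial (a b : V →₀ ℕ) [Decidable (a ≤ b)] :
    contraction K V (monomial a 1) (monomial b 1) =
      if a ≤ b then monomial (b - a) (1 : K) else 0 := by
  classical
  have key : ∀ c : V →₀ ℕ, (monomial c (1 : K)) = basisMonomials V K c := fun c => by simp
  rw [key a, contraction, Module.Basis.constr_basis, key b, Module.Basis.constr_basis]
  congr

theorem coeff_contraction_monomial (a b : V →₀ ℕ) (F : MvPolynomial V K) :
    coeff b (contraction K V (monomial a 1) F) = coeff (a + b) F := by
  classical
  induction F using MvPolynomial.induction_on' with
  | monomial c r =>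
    have hr : monomial c r = r • monomial c (1 : K) := by simp [smul_monomial]
    rw [hr, map_smul, coeff_smul, coeff_smul, contraction_monomial_monomial]
    congr 1
    split_ifs with h
    · rw [coeff_monomial, coeff_monomial]
      refine if_congr ?_ rfl rfl
      rw [tsub_eq_iff_eq_add_of_le h, add_comm]
    · rw [coeff_monomial, if_neg, coeff_zero]
      intro h0
      exact h (by rw [h0]; exact le_self_add)
  | add p q hp hq => rw [map_add, coeff_add, coeff_add, hp, hq]

theorem contraction_mul (p q F : MvPolynomial V K) :
    contraction K V (p * q) F = contraction K V p (contraction K V q F) := by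
  induction p using MvPolynomial.induction_on' with
  | add p₁ p₂ h₁ h₂ => rw [add_mul, map_add, LinearMap.add_apply, h₁, h₂, map_add,
      LinearMap.add_apply]
  | monomial a r =>
    induction q using MvPolynomial.induction_on' with
    | add q₁ q₂ h₁ h₂ =>
      rw [mul_add, map_add, LinearMap.add_apply, h₁, h₂, ← map_add, map_add (contraction K V) q₁,
        LinearMap.add_apply]
    | monomial b s =>
      have hr : monomial a r = r • monomial a (1 : K) := by simp [smul_monomial]
      have hs : monomial b s = s • monomial b (1 : K) := by simp [smul_monomial]
      rw [hr, hs, smul_mul_smul_comm, monomial_mul, one_mul]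
      simp only [map_smul, LinearMap.smul_apply, mul_smul]
      rw [smul_comm s r]
      refine congrArg (fun x : MvPolynomial V K => r • s • x) ?_
      ext c
      rw [coeff_contraction_monomial, coeff_contraction_monomial, coeff_contraction_monomial,
        ← add_assoc, add_comm b a]

/-- The ideal of all `g` with `g ∘ F = 0`. -/
noncomputable def contractionAnnihilator (F : MvPolynomial V K) : Ideal (MvPolynomial V K) where
  carrier := {g | contraction K V g F = 0}
  add_mem' := by
    intro g h hg hh
    rw [Set.mem_ofPred_eq] at *
    rw [map_add, LinearMap.add_apply, hg, hh, add_zero]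
  zero_mem' := by simp
  smul_mem' := by
    intro g h hh
    rw [Set.mem_ofPred_eq] at *
    rw [smul_eq_mul, contraction_mul, hh, map_zero]

theorem mem_contractionAnnihilator {F g : MvPolynomial V K} :
    g ∈ contractionAnnihilator F ↔ contraction K V g F = 0 :=
  Iff.rfl

theorem mem_inverseSystem_iff_le {I : Ideal (MvPolynomial V K)} {F : MvPolynomial V K} :
    F ∈ inverseSystem I ↔ I ≤ contractionAnnihilator F :=
  Iff.rfl

/-- The linear functional `p ↦ (p ∘ F)(0)`. -/
noncomputable def contractionPairing (F : MvPolynomial V K) : MvPolynomial V K →ₗ[K] K :=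
  MvPolynomial.lcoeff K 0 ∘ₗ (contraction K V).flip F

theorem contractionPairing_apply (F p : MvPolynomial V K) :
    contractionPairing F p = coeff 0 (contraction K V p F) :=
  rfl

theorem contractionPairing_monomial (F : MvPolynomial V K) (a : V →₀ ℕ) :
    contractionPairing F (monomial a 1) = coeff a F := by
  rw [contractionPairing_apply, coeff_contraction_monomial, add_zero]

theorem contractionPairing_monomial_mul (F g : MvPolynomial V K) (a : V →₀ ℕ) :
    contractionPairing F (monomial a 1 * g) = coeff a (contraction K V g F) := by
  rw [contractionPairing_apply, contraction_mul, coeff_contraction_monomial, add_zero]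

theorem linearMap_eq_zero_of_monomial {ℓ : MvPolynomial V K →ₗ[K] K}
    (h : ∀ a, ℓ (monomial a 1) = 0) : ℓ = 0 :=
  (basisMonomials V K).ext fun a => by simpa using h a

end Contraction

/-! ### Elementary symmetric polynomials modulo some of the variables. -/

section ElementarySymmetric

variable {K V : Type*} [Field K]

/-- The exponent vector of the squarefree monomial `∏ v ∈ A, x_v`. -/
noncomputable def squarefreeExponent (A : Finset V) : V →₀ ℕ :=
  ∑ v ∈ A, Finsupp.single v 1

theorem squarefreeExponent_apply [DecidableEq V] (A : Finset V) (v : V) :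
    squarefreeExponent A v = if v ∈ A then 1 else 0 := by
  rw [squarefreeExponent, Finsupp.finsetSum_apply]
  simp [Finsupp.single_apply]

theorem degree_squarefreeExponent (A : Finset V) :
    (squarefreeExponent A).degree = A.card := by
  simp [squarefreeExponent, map_sum]

theorem prod_X_eq_monomial (A : Finset V) :
    ∏ v ∈ A, (X v : MvPolynomial V K) = monomial (squarefreeExponent A) 1 := by
  rw [squarefreeExponent, monomial_sum_one]
  rfl

theorem coeff_contraction_esymm [Fintype V] (k : ℕ) (b : V →₀ ℕ) (F : MvPolynomial V K) :
    coeff b (contraction K V (esymm V K k) F) =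
      ∑ A ∈ powersetCard k univ, coeff (squarefreeExponent A + b) F := by
  rw [esymm, map_sum, LinearMap.sum_apply, coeff_sum]
  exact sum_congr rfl fun A _ => by rw [prod_X_eq_monomial, coeff_contraction_monomial]

/-- Every other term of e_k contains a variable outside `s`, hence lies in `I`. -/
theorem sum_prod_X_mem_of_esymm_mem [Fintype V] [DecidableEq V] (I : Ideal (MvPolynomial V K))
    (s : Finset V) (hx : ∀ v ∉ s, X v ∈ I) (k : ℕ) (he : esymm V K k ∈ I) :
    ∑ A ∈ powersetCard k s, ∏ v ∈ A, (X v : MvPolynomial V K) ∈ I := by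
  have hsub : powersetCard k s ⊆ powersetCard k (univ : Finset V) :=
    powersetCard_mono (subset_univ s)
  rw [esymm, ← sum_sdiff hsub] at he
  refine (Ideal.add_mem_iff_right I (Ideal.sum_mem _ fun A hA => ?_)).1 he
  rw [mem_sdiff, mem_powersetCard, mem_powersetCard] at hA
  have hAs : ¬ A ⊆ s := fun h => hA.2 ⟨h, hA.1.2⟩
  obtain ⟨v, hvA, hvs⟩ := not_subset.1 hAs
  exact I.mem_of_dvd (dvd_prod_of_mem _ hvA) (hx v hvs)

/-- Modulo the variables outside `s` and `e_1, …, e_{|s|}`, the power `x_v ^ |s|` vanishes. -/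
theorem X_pow_card_mem [Fintype V] [DecidableEq V] (I : Ideal (MvPolynomial V K))
    (s : Finset V) (hx : ∀ v ∉ s, X v ∈ I)
    (he : ∀ k, 1 ≤ k → k ≤ s.card → esymm V K k ∈ I) (v : V) (hv : v ∈ s) :
    (X v : MvPolynomial V K) ^ s.card ∈ I := by
  -- The factor at u = v vanishes. Expanding the product writes x_v^|s| as a combination of the
  -- elementary symmetric polynomials of positive degree in the variables of `s`.
  have h0 : ∏ u ∈ s, (-X u + X v : MvPolynomial V K) = 0 := prod_eq_zero hv (by ring)
  rw [prod_add, sum_powerset, sum_range_succ'] at h0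
  simp only [powersetCard_zero, sum_singleton, prod_empty, one_mul, sdiff_empty,
    prod_const] at h0
  rw [eq_neg_of_add_eq_zero_right h0]
  refine I.neg_mem (I.sum_mem fun j hj => ?_)
  rw [mem_range] at hj
  have : ∑ A ∈ powersetCard (j + 1) s,
      (∏ u ∈ A, (-X u : MvPolynomial V K)) * X v ^ (s \ A).card =
      ((-1) ^ (j + 1) * X v ^ (s.card - (j + 1))) *
        ∑ A ∈ powersetCard (j + 1) s, ∏ u ∈ A, (X u : MvPolynomial V K) := by
    rw [mul_sum]
    refine sum_congr rfl fun A hA => ?_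
    rw [mem_powersetCard] at hA
    rw [prod_neg, card_sdiff_of_subset hA.1, hA.2]
    ring
  rw [this]
  exact I.mul_mem_left _ (sum_prod_X_mem_of_esymm_mem I s hx _ (he _ (by omega) (by omega)))

end ElementarySymmetric

/-! ### The top degree of the coinvariant algebra, in terms of functionals. -/

section Uniqueness

variable {K V : Type*} [Field K]

/-- The largest ideal contained in the kernel of a linear functional. -/
def functionalAnnihilator (ℓ : MvPolynomial V K →ₗ[K] K) : Ideal (MvPolynomial V K) where
  carrier := {g | ∀ h, ℓ (g * h) = 0}
  add_mem' := by
    intro f g hf hg h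
    rw [add_mul, map_add, hf, hg, add_zero]
  zero_mem' := by intro h; simp
  smul_mem' := by
    intro c g hg h
    rw [smul_eq_mul, mul_comm c g, mul_assoc, hg]

theorem degree_sum_single {n : ℕ} (w : Fin n → V) (f : Fin n → ℕ) :
    (∑ j, Finsupp.single (w j) (f j)).degree = ∑ j, f j := by
  simp [map_sum]

theorem sum_fin_val (n : ℕ) : ∑ j : Fin n, (j : ℕ) = n.choose 2 := by
  rw [Fin.sum_univ_eq_sum_range (fun j => j), sum_range_id, Nat.choose_two_right]

/-- The coinvariant algebra in `n` variables vanishes above degree `n.choose 2`, and is spanned in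
that degree by the staircase monomial of any ordering of the variables. -/
theorem functional_eq_zero [Fintype V] (n : ℕ) : ∀ (w : Fin n → V), Function.Injective w →
    ∀ (N : ℕ), n.choose 2 ≤ N → ∀ ℓ : MvPolynomial V K →ₗ[K] K,
    (∀ v ∉ Set.range w, X v ∈ functionalAnnihilator ℓ) →
    (∀ k, 1 ≤ k → k ≤ n → esymm V K k ∈ functionalAnnihilator ℓ) →
    (∀ a : V →₀ ℕ, a.degree ≠ N → ℓ (monomial a 1) = 0) →
    ℓ (monomial (∑ j, Finsupp.single (w j) (j : ℕ)) 1) = 0 → ℓ = 0 := by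
  classical
  induction n with
  | zero =>
    intro w _ N _ ℓ hx _ _ hst
    refine linearMap_eq_zero_of_monomial fun a => ?_
    by_cases ha : a = 0
    · simpa [ha] using hst
    · obtain ⟨v, hv⟩ := Finsupp.ne_iff.1 ha
      obtain ⟨q, hq⟩ : (X v : MvPolynomial V K) ∣ monomial a 1 :=
        X_dvd_monomial.2 (Or.inr hv)
      rw [hq]
      exact hx v (by simp) q
  | succ n ih =>
    intro w hw N hN ℓ hx he hhom hst
    set v := w (Fin.last n) with hv
    have hchoose : (n + 1).choose 2 = n + n.choose 2 := by
      rw [Nat.choose_succ_succ' n 1, Nat.choose_one_right]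
    -- Peel off the last variable: ℓ = L 0 is reached by descending induction from L (n + 1) = 0.
    let L : ℕ → MvPolynomial V K →ₗ[K] K := fun j => ℓ ∘ₗ LinearMap.mulLeft K (X v ^ j)
    have hL : ∀ j h, L j h = ℓ (X v ^ j * h) := fun _ _ => rfl
    have hann : ∀ j g, g ∈ functionalAnnihilator ℓ → g ∈ functionalAnnihilator (L j) := by
      intro j g hg h
      rw [hL, mul_left_comm]
      exact hg _
    have htop : L (n + 1) = 0 := by
      have hcard : (univ.image w).card = n + 1 := by
        rw [card_image_of_injective _ hw, card_univ, Fintype.card_fin]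
      have := X_pow_card_mem (functionalAnnihilator ℓ) (univ.image w)
        (fun u hu => hx u (by simpa using hu)) (by rwa [hcard]) v
        (mem_image_of_mem _ (mem_univ _))
      rw [hcard] at this
      exact LinearMap.ext fun h => this h
    -- If L (j + 1) = 0, then x_v annihilates L j, which therefore involves only n variables. It
    -- lives in degree N - j ≥ binom(n, 2) because j ≤ n.
    have hstep : ∀ j, j ≤ n → L (j + 1) = 0 → L j = 0 := by
      intro j hj hnext
      refine ih (fun i => w i.castSucc) (fun a b h => Fin.castSucc_injective n (hw h)) (N - j)
        (by omega) (L j) ?_ (fun k h1 h2 => hann j _ (he k h1 (by omega))) ?_ ?_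
      · intro u hu
        by_cases huv : u = v
        · intro h
          rw [huv, hL, ← mul_assoc, ← pow_succ, ← hL, hnext, LinearMap.zero_apply]
        · refine hann j _ (hx u ?_)
          rintro ⟨i, rfl⟩
          induction i using Fin.lastCases with
          | last => exact huv rfl
          | cast i => exact hu ⟨i, rfl⟩
      · intro a ha
        rw [hL, X_pow_eq_monomial, monomial_mul, one_mul]
        refine hhom _ ?_
        rw [map_add, Finsupp.degree_single]
        omega
      · rw [hL, X_pow_eq_monomial, monomial_mul, one_mul]
        -- Only j = n uses the hypothesis on the staircase; for j < n the smaller staircase times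
        -- x_v^j has degree below N.
        rcases eq_or_lt_of_le hj with rfl | hlt
        · rw [Fin.sum_univ_castSucc] at hst
          rw [add_comm]
          simpa using hst
        · refine hhom _ ?_
          rw [map_add, Finsupp.degree_single, degree_sum_single, sum_fin_val]
          omega
    have hall : ∀ r, r ≤ n + 1 → L (n + 1 - r) = 0 := by
      intro r
      induction r with
      | zero => intro _; exact htop
      | succ r ihr =>
        intro hr
        refine hstep _ (by omega) ?_
        rw [show n + 1 - (r + 1) + 1 = n + 1 - r by omega]
        exact ihr (by omega)
    have h0 := hall (n + 1) le_rfl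
    refine LinearMap.ext fun p => ?_
    have := LinearMap.congr_fun h0 p
    rwa [Nat.sub_self, hL, pow_zero, one_mul] at this

end Uniqueness

/-! ### Staircase exponents and the terms with a given support. -/

section Staircase

variable {K V : Type*} [Field K]

/-- The exponent vector of `∏ j, x_{w j} ^ (j + 1)`. -/
noncomputable def staircase {n : ℕ} (w : Fin n → V) : V →₀ ℕ :=
  ∑ j, Finsupp.single (w j) ((j : ℕ) + 1)

theorem degree_staircase {n : ℕ} (w : Fin n → V) : (staircase w).degree = (n + 1).choose 2 := by
  rw [staircase, degree_sum_single, sum_add_distrib, sum_fin_val]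
  simp [Nat.choose_succ_succ' n 1, add_comm]

theorem staircase_eq_add [DecidableEq V] {n : ℕ} (w : Fin n → V) (hw : Function.Injective w) :
    staircase w = squarefreeExponent (univ.image w) +
      ∑ j, Finsupp.single (w j) (j : ℕ) := by
  rw [squarefreeExponent, sum_image fun a _ b _ h => hw h, ← sum_add_distrib, staircase]
  exact sum_congr rfl fun j _ => by rw [← Finsupp.single_add, add_comm]

/-- A form of degree at least `(n + 1).choose 2` without terms of support larger than
`range w`, and annihilated by `e_1, …, e_n` on the terms divisible by `∏ j, y_{w j}`, has no term
divisible by `∏ j, y_{w j}` if it has none with exponent `staircase w`. -/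
theorem coeff_eq_zero_of_staircase [Fintype V] [DecidableEq V] {n N : ℕ} (w : Fin n → V)
    (hw : Function.Injective w) (hN : (n + 1).choose 2 ≤ N) (G : MvPolynomial V K)
    (hhom : ∀ a : V →₀ ℕ, a.degree ≠ N → coeff a G = 0)
    (hbig : ∀ a : V →₀ ℕ, univ.image w ⊂ a.support → coeff a G = 0)
    (he : ∀ k, 1 ≤ k → k ≤ n → ∀ a : V →₀ ℕ, univ.image w ⊆ a.support →
      coeff a (contraction K V (esymm V K k) G) = 0)
    (hst : coeff (staircase w) G = 0) (a : V →₀ ℕ) (ha : univ.image w ⊆ a.support) :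
    coeff a G = 0 := by
  set σ := univ.image w with hσ
  have hcard : σ.card = n := by
    rw [hσ, card_image_of_injective _ hw, card_univ, Fintype.card_fin]
  have hchoose : (n + 1).choose 2 = n + n.choose 2 := by
    rw [Nat.choose_succ_succ' n 1, Nat.choose_one_right]
  -- Factoring out the squarefree monomial of σ turns the exponents 1, …, n into 0, …, n - 1 and
  -- lowers the degree by n. A variable outside σ annihilates ℓ because it enlarges the support.
  let ℓ : MvPolynomial V K →ₗ[K] K :=
    contractionPairing G ∘ₗ LinearMap.mulLeft K (monomial (squarefreeExponent σ) 1)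
  have hℓ : ∀ h, ℓ h = contractionPairing G (monomial (squarefreeExponent σ) 1 * h) :=
    fun _ => rfl
  have hℓm : ∀ b, ℓ (monomial b 1) = coeff (squarefreeExponent σ + b) G := by
    intro b
    rw [hℓ, monomial_mul, one_mul, contractionPairing_monomial]
  have hsupp : ∀ b : V →₀ ℕ, σ ⊆ (squarefreeExponent σ + b).support := by
    intro b v hv
    rw [Finsupp.mem_support_iff, Finsupp.add_apply, squarefreeExponent_apply, if_pos hv]
    omega
  have hext : ∀ g, (∀ b, ℓ (g * monomial b 1) = 0) → g ∈ functionalAnnihilator ℓ := by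
    intro g hg
    have : ℓ ∘ₗ LinearMap.mulLeft K g = 0 := linearMap_eq_zero_of_monomial hg
    exact fun h => LinearMap.congr_fun this h
  have h0 : ℓ = 0 := by
    refine functional_eq_zero n w hw (N - n) (by omega) ℓ ?_ ?_ ?_ ?_
    · intro v hv
      refine hext _ fun b => ?_
      have hX : (X v : MvPolynomial V K) = monomial (Finsupp.single v 1) 1 := rfl
      rw [hX, monomial_mul, one_mul, hℓm]
      have hvσ : v ∉ σ := by simpa [hσ] using hv
      refine hbig _ ((hsupp _).ssubset_of_mem_notMem (a := v) ?_ hvσ)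
      rw [mem_coe, Finsupp.mem_support_iff, Finsupp.add_apply, Finsupp.add_apply,
        Finsupp.single_eq_same]
      omega
    · intro k h1 h2
      refine hext _ fun b => ?_
      rw [hℓ, mul_comm (esymm V K k), ← mul_assoc, monomial_mul, one_mul,
        contractionPairing_monomial_mul]
      exact he k h1 h2 _ (hsupp _)
    · intro b hb
      rw [hℓm]
      refine hhom _ ?_
      rw [map_add, degree_squarefreeExponent, hcard]
      omega
    · rw [hℓm, ← staircase_eq_add w hw]
      exact hst
  have hle : squarefreeExponent σ ≤ a := by
    intro v
    rw [squarefreeExponent_apply]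
    split_ifs with hv
    · exact Nat.one_le_iff_ne_zero.2 (Finsupp.mem_support_iff.1 (ha hv))
    · exact Nat.zero_le _
  have := LinearMap.congr_fun h0 (monomial (a - squarefreeExponent σ) 1)
  rwa [hℓm, add_tsub_cancel_of_le hle, LinearMap.zero_apply] at this

end Staircase

section FinOrderings

variable {V : Type*} [LinearOrder V]

theorem image_orderEmbOfFin (σ : Finset V) {n : ℕ} (h : σ.card = n) :
    univ.image (σ.orderEmbOfFin h) = σ := by
  rw [← coe_inj, coe_image, coe_univ, Set.image_univ, range_orderEmbOfFin]

theorem image_cons {n : ℕ} (v : V) (w : Fin n → V) :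
    univ.image (Fin.cons v w : Fin (n + 1) → V) = insert v (univ.image w) := by
  ext u
  simp [Fin.exists_fin_succ, eq_comm]

end FinOrderings

/-! ### Stresses described by coefficients, and their vanishing. -/

namespace PreAbstractSimplicialComplex

section Faces

variable {V : Type*} (Δ : PreAbstractSimplicialComplex V)

theorem IsFace.mono {σ τ : Finset V} (hσ : Δ.IsFace σ) (h : τ ⊆ σ) : Δ.IsFace τ := by
  rcases τ.eq_empty_or_nonempty with rfl | hτ
  · exact Or.inl rfl
  rcases hσ with rfl | hσ
  · exact absurd (subset_empty.1 h) hτ.ne_empty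
  · exact Or.inr ((Δ.isRelLowerSet_faces hσ).2 h hτ)

open Classical in
/-- The maximal number of vertices of a face. -/
noncomputable def maxCard [Fintype V] : ℕ :=
  (univ.filter fun σ : Finset V => Δ.IsFace σ).sup card

theorem dim_eq [Fintype V] : Δ.dim = (Δ.maxCard : ℤ) - 1 :=
  rfl

theorem IsFace.card_le [Fintype V] {σ : Finset V} (hσ : Δ.IsFace σ) : σ.card ≤ Δ.maxCard := by
  classical
  exact le_sup (f := card) (mem_filter.2 ⟨mem_univ _, hσ⟩)

end Faces

section Stresses

variable {K V : Type*} [Field K] [Fintype V] (Δ : PreAbstractSimplicialComplex V)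

theorem mem_coinvariantStresses {k : ℕ} {F : MvPolynomial V K} :
    F ∈ Δ.coinvariantStresses K k ↔
      (∀ a : V →₀ ℕ, a.degree ≠ k → coeff a F = 0) ∧
      (∀ a : V →₀ ℕ, ¬ Δ.IsFace a.support → coeff a F = 0) ∧
      ∀ i, 1 ≤ i → i ≤ Δ.maxCard → contraction K V (esymm V K i) F = 0 := by
  classical
  rw [coinvariantStresses, inverseSystemDegree, Submodule.mem_inf, mem_inverseSystem_iff_le,
    coinvariantIdeal, sup_le_iff, stanleyReisnerIdeal, Ideal.span_le, Ideal.span_le,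
    mem_homogeneousSubmodule]
  constructor
  · rintro ⟨⟨h1, h2⟩, h3⟩
    refine ⟨fun a ha => h3.coeff_eq_zero ha, fun a ha => ?_, fun i hi hiD => ?_⟩
    · have := h1 ⟨a.support, ha, rfl⟩
      rw [SetLike.mem_coe, mem_contractionAnnihilator, prod_X_eq_monomial] at this
      have hle : squarefreeExponent a.support ≤ a := by
        intro v
        rw [squarefreeExponent_apply]
        split_ifs with hv
        · exact Nat.one_le_iff_ne_zero.2 (Finsupp.mem_support_iff.1 hv)
        · exact Nat.zero_le _
      rw [← add_tsub_cancel_of_le hle, ← coeff_contraction_monomial, this, coeff_zero]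
    · exact h2 ⟨i, hi, by rw [dim_eq]; omega, rfl⟩
  · rintro ⟨h1, h2, h3⟩
    refine ⟨⟨?_, ?_⟩, ?_⟩
    · rintro _ ⟨τ, hτ, rfl⟩
      rw [SetLike.mem_coe, mem_contractionAnnihilator, prod_X_eq_monomial]
      ext b
      rw [coeff_contraction_monomial, coeff_zero]
      refine h2 _ fun hf => hτ (IsFace.mono Δ hf fun v hv => ?_)
      rw [Finsupp.mem_support_iff, Finsupp.add_apply, squarefreeExponent_apply, if_pos hv]
      omega
    · rintro _ ⟨i, hi, hid, rfl⟩
      rw [dim_eq] at hid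
      exact h3 i hi (by omega)
    · intro a ha
      by_contra hne
      refine ha (h1 a ?_)
      rw [Finsupp.degree_eq_weight_one]
      exact hne

theorem coinvariantStress_eq_zero [LinearOrder V] {F : MvPolynomial V K}
    (hF : F ∈ Δ.coinvariantStresses K ((Δ.maxCard + 1).choose 2))
    (hst : ∀ (σ : Finset V) (h : σ.card = Δ.maxCard),
      coeff (staircase (σ.orderEmbOfFin h)) F = 0) : F = 0 := by
  obtain ⟨hhom, hface, he⟩ := Δ.mem_coinvariantStresses.1 hF
  -- Descending induction on the size of the support, starting above the size of any face.
  have main : ∀ r, ∀ a : V →₀ ℕ, Δ.maxCard < a.support.card + r → coeff a F = 0 := by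
    intro r
    induction r with
    | zero =>
      intro a ha
      exact hface a fun h => by have := IsFace.card_le Δ h; omega
    | succ r ih =>
      intro a ha
      by_cases hlt : Δ.maxCard < a.support.card + r
      · exact ih a hlt
      set w := a.support.orderEmbOfFin rfl with hw
      have himg : univ.image w = a.support := image_orderEmbOfFin _ rfl
      refine coeff_eq_zero_of_staircase w w.injective
        (Nat.choose_le_choose 2 (by omega)) F hhom ?_ ?_ ?_ a himg.le
      · intro b hb
        rw [himg] at hb
        have := card_lt_card hb
        exact ih b (by omega)
      · intro k h1 h2 b _
        rw [he k h1 (by omega), coeff_zero]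
      · by_cases hD : a.support.card = Δ.maxCard
        · have : ∀ (n : ℕ) (h : a.support.card = n), n = Δ.maxCard →
              coeff (staircase (a.support.orderEmbOfFin h)) F = 0 := by
            rintro n h rfl
            exact hst _ h
          exact this _ rfl hD
        -- A staircase on fewer than D vertices has degree less than t, so its coefficient vanishes.
        · refine hhom _ ?_
          rw [degree_staircase]
          have h1 : (a.support.card + 1).choose 2 < (a.support.card + 2).choose 2 := by
            have := Nat.choose_succ_succ' (a.support.card + 1) 1
            rw [Nat.choose_one_right] at this
            exact this ▸ Nat.lt_add_of_pos_left (Nat.succ_pos _)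
          have h2 := Nat.choose_le_choose 2
            (show a.support.card + 2 ≤ Δ.maxCard + 1 by omega)
          omega
  ext a
  exact main (Δ.maxCard + 1) a (by omega)

end Stresses

end PreAbstractSimplicialComplex

/-! ### Orientations and the boundary map on orderings. -/

section Orientation

variable (K : Type*) [Field K] {V : Type*} [LinearOrder V]

/-- `1`, `0`, `-1` according to whether `a < b`, `a = b`, `a > b`. -/
def orderSign (a b : V) : K :=
  if a < b then 1 else if b < a then -1 else 0

theorem orderSign_antisymm (a b : V) : orderSign K a b = -orderSign K b a := by
  unfold orderSign
  rcases lt_trichotomy a b with h | rfl | h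
  · simp [h, h.not_gt]
  · simp
  · simp [h, h.not_gt]

theorem orderSign_self (a : V) : orderSign K a a = 0 := by
  simp [orderSign]

/-- The sign of the ordering `w` of the set `range w`, and `0` if `w` is not injective. -/
def orientation {n : ℕ} (w : Fin n → V) : K :=
  ∏ i, ∏ j ∈ Ioi i, orderSign K (w i) (w j)

theorem orientation_cons {n : ℕ} (v : V) (w : Fin n → V) :
    orientation K (Fin.cons v w : Fin (n + 1) → V) =
      (∏ j, orderSign K v (w j)) * orientation K w := by
  simp only [orientation, Fin.prod_univ_succ, Fin.prod_Ioi_succ, Fin.prod_Ioi_zero, Fin.cons_zero,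
    Fin.cons_succ]

theorem orientation_comp_perm {n : ℕ} (w : Fin n → V) (π : Equiv.Perm (Fin n)) :
    orientation K (w ∘ π) = (Equiv.Perm.sign π : ℤ) * orientation K w :=
  π.prod_Ioi_comp_eq_sign_mul_prod (f := fun i j => orderSign K (w i) (w j))
    fun _ _ => orderSign_antisymm K _ _

theorem orientation_eq_zero {n : ℕ} {w : Fin n → V} (hw : ¬ Function.Injective w) :
    orientation K w = 0 := by
  have key : ∀ i j, i < j → w i = w j → orientation K w = 0 := fun i j hij h =>
    prod_eq_zero (mem_univ i) (prod_eq_zero (mem_Ioi.2 hij) (by rw [h, orderSign_self]))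
  simp only [Function.Injective, not_forall] at hw
  obtain ⟨i, j, h, hne⟩ := hw
  rcases lt_or_gt_of_ne hne with hlt | hlt
  · exact key i j hlt h
  · exact key j i hlt h.symm

theorem orientation_strictMono {n : ℕ} {w : Fin n → V} (hw : StrictMono w) :
    orientation K w = 1 :=
  prod_eq_one fun i _ => prod_eq_one fun j hj => by
    rw [orderSign, if_pos (hw (mem_Ioi.1 hj))]

variable {K}

theorem prod_orderSign {n : ℕ} {w : Fin n → V} (hw : Function.Injective w) {v : V}
    (hv : v ∉ univ.image w) :
    ∏ j, orderSign K v (w j) = (-1) ^ ((univ.image w).filter (· < v)).card := by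
  have h1 : ∏ u ∈ univ.image w, orderSign K v u = ∏ j, orderSign K v (w j) :=
    prod_image fun a _ b _ h => hw h
  rw [← h1, ← prod_const, prod_filter]
  refine prod_congr rfl fun u hu => ?_
  have hne : v ≠ u := fun h => hv (h ▸ hu)
  unfold orderSign
  rcases lt_or_gt_of_ne hne with h | h
  · simp [h, h.not_gt]
  · simp [h, h.not_gt]

/-- The alternating function on orderings that a simplicial chain `c` defines. -/
def orientedCoeff (c : Finset V → K) {n : ℕ} (w : Fin n → V) : K :=
  orientation K w * c (univ.image w)

theorem orientedCoeff_eq_zero (c : Finset V → K) {n : ℕ} {w : Fin n → V}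
    (hw : ¬ Function.Injective w) : orientedCoeff c w = 0 := by
  rw [orientedCoeff, orientation_eq_zero K hw, zero_mul]

theorem orientedCoeff_orderEmbOfFin (c : Finset V → K) {n : ℕ} (σ : Finset V) (h : σ.card = n) :
    orientedCoeff c (σ.orderEmbOfFin h) = c σ := by
  rw [orientedCoeff, orientation_strictMono K (σ.orderEmbOfFin h).strictMono, one_mul,
    image_orderEmbOfFin]

theorem orientedCoeff_comp_swap (c : Finset V → K) {n : ℕ} (w : Fin n → V) {i j : Fin n}
    (hij : i ≠ j) : orientedCoeff c (w ∘ Equiv.swap i j) = -orientedCoeff c w := by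
  have himg : univ.image (w ∘ Equiv.swap i j) = univ.image w := by
    rw [← image_image, image_univ_equiv]
  rw [orientedCoeff, orientation_comp_perm, Equiv.Perm.sign_swap hij, himg, orientedCoeff]
  simp

variable [Fintype V]

open PreAbstractSimplicialComplex in
theorem boundary_apply (c : Finset V → K) (τ : Finset V) :
    boundary K c τ =
      ∑ v ∈ univ \ τ, (-1) ^ (τ.filter (· < v)).card * c (insert v τ) := by
  have h1 : boundary K c τ = ∑ σ : Finset V, ∑ v ∈ σ,
      if σ.erase v = τ then (-1) ^ (σ.filter (· < v)).card * c σ else 0 := by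
    rw [boundary, Fintype.linearCombination_apply, Finset.sum_apply]
    refine sum_congr rfl fun σ _ => ?_
    rw [Pi.smul_apply, Finset.sum_apply, smul_eq_mul, mul_sum]
    refine sum_congr rfl fun v _ => ?_
    rw [Pi.single_apply]
    by_cases h : σ.erase v = τ
    · rw [if_pos h.symm, if_pos h, mul_comm]
    · rw [if_neg (Ne.symm h), if_neg h, mul_zero]
  rw [h1, sum_comm' (t' := univ) (s' := fun v => univ.filter (v ∈ ·)) (by simp),
    ← sum_subset (subset_univ (univ \ τ))]
  · refine sum_congr rfl fun v hv => ?_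
    have hvτ : v ∉ τ := (mem_sdiff.1 hv).2
    rw [sum_eq_single (insert v τ)]
    · rw [erase_insert hvτ, if_pos rfl, filter_insert, if_neg (lt_irrefl v)]
    · intro σ hσ hne
      refine if_neg fun h => hne ?_
      rw [← h, insert_erase (mem_filter.1 hσ).2]
    · intro h
      exact (h (by simp)).elim
  · intro v _ hv
    have hvτ : v ∈ τ := by simpa using hv
    refine sum_eq_zero fun σ _ => if_neg fun h => ?_
    rw [← h] at hvτ
    exact notMem_erase v σ hvτ

/-- Prepending v to `w` multiplies the orientation by (-1) to the number of entries below v, which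
is the sign in the boundary map. A repeated v contributes zero, so the sum can run over all
vertices. -/
theorem sum_orientedCoeff_cons (c : Finset V → K) {n : ℕ} (w : Fin n → V) :
    ∑ v, orientedCoeff c (Fin.cons v w : Fin (n + 1) → V) =
      orientation K w * PreAbstractSimplicialComplex.boundary K c (univ.image w) := by
  by_cases hw : Function.Injective w
  · rw [boundary_apply, mul_sum, ← sum_subset (subset_univ (univ \ univ.image w))]
    · refine sum_congr rfl fun v hv => ?_
      rw [orientedCoeff, orientation_cons, prod_orderSign hw (mem_sdiff.1 hv).2, image_cons]
      ring
    · intro v _ hv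
      refine orientedCoeff_eq_zero c fun hinj => ?_
      have : v ∈ univ.image w := by simpa using hv
      obtain ⟨i, _, hi⟩ := mem_image.1 this
      have := @hinj 0 i.succ (by rw [Fin.cons_zero, Fin.cons_succ, hi])
      exact absurd this (Fin.succ_ne_zero i).symm
  · rw [orientation_eq_zero K hw, zero_mul]
    refine sum_eq_zero fun v _ => orientedCoeff_eq_zero c fun hinj => hw fun i j h => ?_
    exact Fin.succ_injective n (@hinj i.succ j.succ (by rwa [Fin.cons_succ, Fin.cons_succ]))

end Orientation

/-! ### The form attached to a chain, and its contractions by e_k. -/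

section StressOfChain

variable {K V : Type*} [Field K]

theorem sum_single_apply_of_injective {n : ℕ} {w : Fin n → V} (hw : Function.Injective w)
    (f : Fin n → ℕ) (i : Fin n) : (∑ j, Finsupp.single (w j) (f j)) (w i) = f i := by
  rw [Finsupp.finsetSum_apply, sum_eq_single i]
  · exact Finsupp.single_eq_same
  · intro j _ hj
    exact Finsupp.single_eq_of_ne fun h => hj (hw h.symm)
  · intro h
    exact absurd (mem_univ i) h

theorem sum_single_apply_of_notMem {n : ℕ} {w : Fin n → V} (f : Fin n → ℕ) {v : V}
    (hv : v ∉ Set.range w) : (∑ j, Finsupp.single (w j) (f j)) v = 0 := by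
  rw [Finsupp.finsetSum_apply]
  exact sum_eq_zero fun j _ => Finsupp.single_eq_of_ne fun h => hv ⟨j, h.symm⟩

theorem support_sum_single_subset [DecidableEq V] {n : ℕ} (w : Fin n → V) (f : Fin n → ℕ) :
    (∑ j, Finsupp.single (w j) (f j)).support ⊆ univ.image w := by
  intro v hv
  by_contra h
  exact Finsupp.mem_support_iff.1 hv (sum_single_apply_of_notMem f (by simpa using h))

theorem staircase_apply {n : ℕ} {w : Fin n → V} (hw : Function.Injective w) (i : Fin n) :
    staircase w (w i) = (i : ℕ) + 1 :=
  sum_single_apply_of_injective hw _ i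

theorem support_staircase [DecidableEq V] {n : ℕ} {w : Fin n → V} (hw : Function.Injective w) :
    (staircase w).support = univ.image w := by
  refine (support_sum_single_subset w _).antisymm fun v hv => ?_
  obtain ⟨i, _, rfl⟩ := mem_image.1 hv
  rw [Finsupp.mem_support_iff]
  exact (staircase_apply hw i).trans_ne (Nat.succ_ne_zero _)

/-- The exponents are distinct, so the ordering can be read off: `w i` is the vertex of exponent i +
1. -/
theorem staircase_injOn {n : ℕ} {w w' : Fin n → V} (hw : Function.Injective w)
    (hw' : Function.Injective w') (h : staircase w = staircase w') : w = w' := by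
  ext1 i
  have h1 : staircase w' (w i) = i + 1 := by
    rw [← h, staircase_apply hw]
  by_cases hi : w i ∈ Set.range w'
  · obtain ⟨j, hj⟩ := hi
    rw [← hj, staircase_apply hw'] at h1
    rw [← hj, show j = i from Fin.ext (by omega)]
  · rw [staircase, sum_single_apply_of_notMem _ hi] at h1
    omega

/-- The exponent vector of `∏ j, x_{w j} ^ (j + 1)` divided by `∏ j ∈ T, x_{w j}`. -/
noncomputable def loweredStaircase {n : ℕ} (T : Finset (Fin n)) (w : Fin n → V) : V →₀ ℕ :=
  ∑ j, Finsupp.single (w j) ((j : ℕ) + 1 - if j ∈ T then 1 else 0)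

theorem staircase_sub [DecidableEq V] {n : ℕ} (w : Fin n ↪ V) (T : Finset (Fin n)) :
    staircase w - squarefreeExponent (T.map w) = loweredStaircase T w := by
  ext v
  rw [Finsupp.tsub_apply, squarefreeExponent_apply, staircase, loweredStaircase]
  by_cases hv : v ∈ Set.range w
  · obtain ⟨i, rfl⟩ := hv
    rw [sum_single_apply_of_injective w.injective, sum_single_apply_of_injective w.injective]
    simp
  · rw [sum_single_apply_of_notMem _ hv, sum_single_apply_of_notMem _ hv, Nat.zero_sub]

theorem contraction_esymm_staircase [Fintype V] {n : ℕ} {w : Fin n → V}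
    (hw : Function.Injective w) (k : ℕ) :
    contraction K V (esymm V K k) (monomial (staircase w) 1) =
      ∑ T ∈ powersetCard k univ, monomial (loweredStaircase T w) 1 := by
  classical
  let e : Fin n ↪ V := ⟨w, hw⟩
  have hsub : powersetCard k (univ.map e) ⊆ powersetCard k (univ : Finset V) :=
    powersetCard_mono (subset_univ _)
  have hle : ∀ A : Finset V, squarefreeExponent A ≤ staircase w ↔ A ⊆ univ.map e := by
    intro A
    have hmap : univ.map e = (staircase w).support := by
      rw [support_staircase hw, map_eq_image]
      rfl
    rw [hmap]
    constructor
    · intro h v hv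
      have := h v
      rw [squarefreeExponent_apply, if_pos hv] at this
      rw [Finsupp.mem_support_iff]
      omega
    · intro h v
      rw [squarefreeExponent_apply]
      split_ifs with hv
      · exact Nat.one_le_iff_ne_zero.2 (Finsupp.mem_support_iff.1 (h hv))
      · exact Nat.zero_le _
  rw [esymm, map_sum, LinearMap.sum_apply, ← sum_subset hsub]
  · rw [powersetCard_map, sum_map]
    refine sum_congr rfl fun T _ => ?_
    change contraction K V (∏ v ∈ T.map e, X v) _ = _
    rw [prod_X_eq_monomial, contraction_monomial_monomial,
      if_pos ((hle _).2 (map_subset_map.2 (subset_univ T)))]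
    exact congrArg (fun a => monomial a (1 : K)) (staircase_sub e T)
  · intro A hA hA'
    rw [prod_X_eq_monomial, contraction_monomial_monomial, if_neg]
    intro h
    exact hA' (mem_powersetCard.2 ⟨(hle A).1 h, (mem_powersetCard.1 hA).2⟩)

theorem exists_castSucc_notMem_succ_mem {n : ℕ} {T : Finset (Fin (n + 1))} (hT : T.Nonempty)
    (h0 : 0 ∉ T) : ∃ i : Fin n, i.castSucc ∉ T ∧ i.succ ∈ T := by
  by_contra! h
  obtain ⟨i, hi⟩ := hT
  have : ∀ j : Fin (n + 1), j ∉ T := by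
    intro j
    induction j using Fin.induction with
    | zero => exact h0
    | succ j ih => exact h j ih
  exact this i hi

theorem loweredStaircase_of_zero_mem {n : ℕ} {T : Finset (Fin (n + 1))} (h0 : 0 ∈ T)
    (w : Fin (n + 1) → V) : loweredStaircase T w =
      ∑ j : Fin n, Finsupp.single (w j.succ) ((j : ℕ) + 2 - if j.succ ∈ T then 1 else 0) := by
  rw [loweredStaircase, Fin.sum_univ_succ, if_pos h0, Fin.val_zero, zero_add, Nat.sub_self,
    Finsupp.single_zero, zero_add]
  rfl

/-- After lowering, positions i and i + 1 both carry the exponent i + 1. -/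
theorem loweredStaircase_comp_swap {n : ℕ} {T : Finset (Fin (n + 1))} {i : Fin n}
    (hi : i.castSucc ∉ T) (hi' : i.succ ∈ T) (w : Fin (n + 1) → V) :
    loweredStaircase T (w ∘ Equiv.swap i.castSucc i.succ) = loweredStaircase T w := by
  rw [loweredStaircase, loweredStaircase,
    ← Equiv.sum_comp (Equiv.swap i.castSucc i.succ)
      fun j => Finsupp.single (w j) ((j : ℕ) + 1 - if j ∈ T then 1 else 0)]
  refine sum_congr rfl fun j _ => ?_
  rw [Function.comp_apply]
  congr 1
  rcases eq_or_ne j i.castSucc with rfl | h1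
  · rw [Equiv.swap_apply_left, if_neg hi, if_pos hi', Fin.val_succ, Fin.val_castSucc]
    omega
  rcases eq_or_ne j i.succ with rfl | h2
  · rw [Equiv.swap_apply_right, if_neg hi, if_pos hi', Fin.val_succ, Fin.val_castSucc]
    omega
  · rw [Equiv.swap_apply_of_ne_of_ne h1 h2]

variable [LinearOrder V] [Fintype V]

/-- The form `∑ w, c(w) ∏ j, y_{w j} ^ (j + 1)` attached to a simplicial chain `c`, where `w` runs
over the orderings of the `n`-element sets. -/
noncomputable def stressOfChain (n : ℕ) (c : Finset V → K) : MvPolynomial V K :=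
  ∑ w : Fin n → V, orientedCoeff c w • monomial (staircase w) 1

theorem coeff_stressOfChain_staircase (c : Finset V → K) {n : ℕ} {w : Fin n → V}
    (hw : Function.Injective w) :
    coeff (staircase w) (stressOfChain n c) = orientedCoeff c w := by
  rw [stressOfChain, coeff_sum, sum_eq_single w]
  · rw [coeff_smul, coeff_monomial, if_pos rfl, smul_eq_mul, mul_one]
  · intro w' _ hne
    by_cases hw' : Function.Injective w'
    · rw [coeff_smul, coeff_monomial, if_neg fun h => hne (staircase_injOn hw' hw h), smul_zero]
    · rw [orientedCoeff_eq_zero c hw', zero_smul, coeff_zero]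
  · intro h
    exact absurd (mem_univ w) h

theorem exists_of_coeff_stressOfChain_ne_zero {c : Finset V → K} {n : ℕ} {a : V →₀ ℕ}
    (h : coeff a (stressOfChain n c) ≠ 0) :
    ∃ w : Fin n → V, Function.Injective w ∧ a = staircase w ∧ c a.support ≠ 0 := by
  rw [stressOfChain, coeff_sum] at h
  obtain ⟨w, _, hw⟩ := exists_ne_zero_of_sum_ne_zero h
  rw [coeff_smul, coeff_monomial] at hw
  have ha : staircase w = a := by
    by_contra hne
    rw [if_neg hne, smul_zero] at hw
    exact hw rfl
  have hc : orientedCoeff c w ≠ 0 := fun h0 => hw (by rw [h0, zero_smul])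
  have hinj : Function.Injective w := by
    by_contra hinj
    exact hc (orientedCoeff_eq_zero c hinj)
  refine ⟨w, hinj, ha.symm, ?_⟩
  rw [← ha, support_staircase hinj]
  exact right_ne_zero_of_mul hc

/-- Swapping two positions of equal lowered exponent is a sign-reversing involution; its fixed
points are not injective and have coefficient zero. -/
theorem sum_loweredStaircase_eq_zero (c : Finset V → K) {n : ℕ} {T : Finset (Fin (n + 1))}
    (hT : T.Nonempty) (h0 : 0 ∉ T) :
    ∑ w : Fin (n + 1) → V,
      orientedCoeff c w • (monomial (loweredStaircase T w) 1 : MvPolynomial V K) = 0 := by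
  obtain ⟨i, hi, hi'⟩ := exists_castSucc_notMem_succ_mem hT h0
  have hne : i.castSucc ≠ i.succ := i.castSucc_lt_succ.ne
  refine sum_involution (fun w _ => w ∘ Equiv.swap i.castSucc i.succ) ?_ ?_
    (fun _ _ => mem_univ _) ?_
  · intro w _
    rw [loweredStaircase_comp_swap hi hi', orientedCoeff_comp_swap c w hne, neg_smul,
      add_neg_cancel]
  · intro w _ hw hfix
    refine hw ?_
    rw [orientedCoeff_eq_zero, zero_smul]
    intro hinj
    have := congrFun hfix i.castSucc
    rw [Function.comp_apply, Equiv.swap_apply_left] at this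
    exact hne (hinj this).symm
  · intro w _
    ext j
    simp

theorem contraction_esymm_stressOfChain (c : Finset V → K) (n : ℕ) {k : ℕ} (hk : 1 ≤ k) :
    contraction K V (esymm V K k) (stressOfChain (n + 1) c) =
      ∑ T ∈ (powersetCard k univ).filter (fun T : Finset (Fin (n + 1)) => 0 ∈ T),
        ∑ w : Fin (n + 1) → V, orientedCoeff c w • monomial (loweredStaircase T w) 1 := by
  have h1 : contraction K V (esymm V K k) (stressOfChain (n + 1) c) =
      ∑ w : Fin (n + 1) → V, ∑ T ∈ powersetCard k univ,
        orientedCoeff c w • monomial (loweredStaircase T w) 1 := by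
    rw [stressOfChain, map_sum]
    refine sum_congr rfl fun w _ => ?_
    rw [map_smul, ← smul_sum]
    by_cases hw : Function.Injective w
    · rw [contraction_esymm_staircase hw]
    · rw [orientedCoeff_eq_zero c hw, zero_smul, zero_smul]
  rw [h1, sum_comm, sum_filter]
  refine sum_congr rfl fun T hT => ?_
  split_ifs with h0
  · rfl
  · refine sum_loweredStaircase_eq_zero c ?_ h0
    rw [← card_pos, (mem_powersetCard.1 hT).2]
    exact hk

theorem contraction_esymm_stressOfChain_of_cycle {c : Finset V → K}
    (hc : PreAbstractSimplicialComplex.boundary K c = 0) (n : ℕ) {k : ℕ} (hk : 1 ≤ k) :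
    contraction K V (esymm V K k) (stressOfChain (n + 1) c) = 0 := by
  rw [contraction_esymm_stressOfChain c n hk]
  refine sum_eq_zero fun T hT => ?_
  have h0 : 0 ∈ T := (mem_filter.1 hT).2
  -- Since 0 ∈ T, the monomial does not depend on the first vertex; the inner sum over it is a value
  -- of ∂c up to sign.
  rw [← Equiv.sum_comp (Fin.consEquiv fun _ => V), Fintype.sum_prod_type, sum_comm]
  refine sum_eq_zero fun w _ => ?_
  simp only [loweredStaircase_of_zero_mem h0, Fin.consEquiv_apply, Fin.cons_succ]
  rw [← sum_smul]
  refine (congrArg (· • _) ((sum_orientedCoeff_cons c w).trans ?_)).trans (zero_smul K _)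
  rw [hc, Pi.zero_apply, mul_zero]

/-- The surviving terms have lost their first vertex. No cycle condition is imposed on `c`, so this
applies to the chain of a stress before that chain is known to be a cycle. -/
theorem coeff_contraction_esymm_stressOfChain (c : Finset V → K) (n : ℕ) {k : ℕ} (hk : 1 ≤ k)
    {a : V →₀ ℕ} (ha : n < a.support.card) :
    coeff a (contraction K V (esymm V K k) (stressOfChain (n + 1) c)) = 0 := by
  rw [contraction_esymm_stressOfChain c n hk, coeff_sum]
  refine sum_eq_zero fun T hT => ?_
  have h0 : 0 ∈ T := (mem_filter.1 hT).2
  rw [coeff_sum]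
  refine sum_eq_zero fun w _ => ?_
  rw [coeff_smul, coeff_monomial, if_neg, smul_zero]
  rintro rfl
  rw [loweredStaircase_of_zero_mem h0] at ha
  have h1 := card_le_card (support_sum_single_subset (fun j : Fin n => w j.succ)
    fun j => (j : ℕ) + 2 - if j.succ ∈ T then 1 else 0)
  have h2 : (univ.image fun j : Fin n => w j.succ).card ≤ n :=
    card_image_le.trans (by simp)
  omega

end StressOfChain

/-! ### The isomorphism between stresses of degree t and top cycles. -/

namespace PreAbstractSimplicialComplex

variable {K V : Type*} [Field K] [LinearOrder V] [Fintype V] (Δ : PreAbstractSimplicialComplex V)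

theorem mem_cycles_dim {c : Finset V → K} : c ∈ Δ.cycles K Δ.dim ↔
    (∀ σ, c σ ≠ 0 → Δ.IsFace σ ∧ σ.card = Δ.maxCard) ∧ boundary K c = 0 := by
  have h : ∀ σ : Finset V, (σ.card : ℤ) - 1 = Δ.dim ↔ σ.card = Δ.maxCard := by
    intro σ
    rw [dim_eq]
    omega
  simp only [← h]
  exact Iff.rfl

theorem boundaries_dim : Δ.boundaries K Δ.dim = ⊥ := by
  have : Δ.chains K (Δ.dim + 1) = ⊥ := by
    rw [eq_bot_iff]
    intro c hc
    rw [Submodule.mem_bot]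
    ext σ
    by_contra hσ
    obtain ⟨hf, hcard⟩ := hc σ hσ
    have := IsFace.card_le Δ hf
    rw [dim_eq] at hcard
    omega
  rw [boundaries, this, Submodule.map_bot]

/-- The chain whose value at a face of maximal dimension is the coefficient of `F` at the staircase
exponent vector of the face. -/
noncomputable def chainOfStress (F : MvPolynomial V K) (σ : Finset V) : K :=
  if h : σ.card = Δ.maxCard then coeff (staircase (σ.orderEmbOfFin h)) F else 0

theorem stressOfChain_mem {c : Finset V → K} (hc : c ∈ Δ.cycles K Δ.dim) :
    stressOfChain Δ.maxCard c ∈ Δ.coinvariantStresses K ((Δ.maxCard + 1).choose 2) := by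
  rw [mem_cycles_dim] at hc
  refine Δ.mem_coinvariantStresses.2 ⟨fun a ha => ?_, fun a ha => ?_, fun i hi hiD => ?_⟩
  · by_contra h
    obtain ⟨w, _, rfl, _⟩ := exists_of_coeff_stressOfChain_ne_zero h
    exact ha (degree_staircase w)
  · by_contra h
    obtain ⟨_, _, _, h0⟩ := exists_of_coeff_stressOfChain_ne_zero h
    exact ha (hc.1 _ h0).1
  · obtain ⟨n, hn⟩ := Nat.exists_eq_succ_of_ne_zero (show Δ.maxCard ≠ 0 by omega)
    rw [hn]
    exact contraction_esymm_stressOfChain_of_cycle hc.2 n hi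

theorem chainOfStress_stressOfChain {c : Finset V → K} (hc : c ∈ Δ.cycles K Δ.dim) :
    Δ.chainOfStress (stressOfChain Δ.maxCard c) = c := by
  ext σ
  rw [chainOfStress]
  split_ifs with h
  · rw [coeff_stressOfChain_staircase c (σ.orderEmbOfFin h).injective,
      orientedCoeff_orderEmbOfFin]
  · by_contra hne
    exact h ((Δ.mem_cycles_dim.1 hc).1 σ (Ne.symm hne)).2

/-- On the exponent vectors with maximal support, a coinvariant stress is alternating. -/
theorem coeff_staircase_eq {F : MvPolynomial V K}
    (hF : F ∈ Δ.coinvariantStresses K ((Δ.maxCard + 1).choose 2))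
    {w : Fin Δ.maxCard → V} (hw : Function.Injective w) :
    coeff (staircase w) F = orientedCoeff (Δ.chainOfStress F) w := by
  obtain ⟨hhom, hface, he⟩ := Δ.mem_coinvariantStresses.1 hF
  set c := Δ.chainOfStress F with hc
  have hcard : (univ.image w).card = Δ.maxCard := by
    rw [card_image_of_injective _ hw, card_univ, Fintype.card_fin]
  set w₀ := (univ.image w).orderEmbOfFin hcard with hw₀
  have himg : univ.image w₀ = univ.image w := image_orderEmbOfFin _ hcard
  -- The difference vanishes at the increasing staircase of the set, hence at every term whose
  -- support contains the set; `stressOfChain` alternates by construction.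
  have hzero : coeff (staircase w) (F - stressOfChain Δ.maxCard c) = 0 := by
    refine coeff_eq_zero_of_staircase w₀ w₀.injective le_rfl _ ?_ ?_ ?_ ?_ _ ?_
    · intro a ha
      rw [coeff_sub, hhom a ha, zero_sub, neg_eq_zero]
      by_contra h
      obtain ⟨u, _, rfl, _⟩ := exists_of_coeff_stressOfChain_ne_zero h
      exact ha (degree_staircase u)
    · intro a ha
      have hlt : Δ.maxCard < a.support.card := by
        rw [← hcard, ← himg]
        exact card_lt_card ha
      rw [coeff_sub, hface a fun h => absurd (IsFace.card_le Δ h) hlt.not_ge, zero_sub,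
        neg_eq_zero]
      by_contra h
      obtain ⟨u, hu, rfl, _⟩ := exists_of_coeff_stressOfChain_ne_zero h
      rw [support_staircase hu, card_image_of_injective _ hu, card_univ, Fintype.card_fin] at hlt
      exact hlt.false
    · intro k h1 h2 a ha
      rw [map_sub, he k h1 h2, zero_sub, coeff_neg, neg_eq_zero]
      have hle : Δ.maxCard ≤ a.support.card := by
        rw [← hcard, ← himg]
        exact card_le_card ha
      obtain ⟨n, hn⟩ := Nat.exists_eq_succ_of_ne_zero (show Δ.maxCard ≠ 0 by omega)
      rw [hn] at hle ⊢
      exact coeff_contraction_esymm_stressOfChain c n h1 hle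
    · rw [coeff_sub, coeff_stressOfChain_staircase c w₀.injective, hw₀,
        orientedCoeff_orderEmbOfFin, hc, chainOfStress, dif_pos hcard, sub_self]
    · rw [support_staircase hw, himg]
  rw [coeff_sub, coeff_stressOfChain_staircase c hw] at hzero
  exact sub_eq_zero.1 hzero

/-- For τ of size D - 1 with increasing ordering `w`, the coefficient of e_D ∘ F at `staircase w` is
the value of the boundary at τ. -/
theorem chainOfStress_mem_cycles {F : MvPolynomial V K}
    (hF : F ∈ Δ.coinvariantStresses K ((Δ.maxCard + 1).choose 2)) :
    Δ.chainOfStress F ∈ Δ.cycles K Δ.dim := by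
  obtain ⟨hhom, hface, he⟩ := Δ.mem_coinvariantStresses.1 hF
  have hsupp : ∀ σ, Δ.chainOfStress F σ ≠ 0 → Δ.IsFace σ ∧ σ.card = Δ.maxCard := by
    intro σ hσ
    rw [chainOfStress] at hσ
    split_ifs at hσ with h
    · refine ⟨?_, h⟩
      by_contra hf
      refine hσ (hface _ ?_)
      rwa [support_staircase (σ.orderEmbOfFin h).injective, image_orderEmbOfFin]
    · exact absurd rfl hσ
  refine Δ.mem_cycles_dim.2 ⟨hsupp, ?_⟩
  set c := Δ.chainOfStress F with hc
  ext τ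
  rw [Pi.zero_apply]
  by_cases hτ : τ.card + 1 = Δ.maxCard
  swap
  · rw [boundary_apply]
    refine sum_eq_zero fun v hv => ?_
    have : c (insert v τ) = 0 := by
      by_contra h0
      have := (hsupp _ h0).2
      rw [card_insert_of_notMem (mem_sdiff.1 hv).2] at this
      exact hτ this
    rw [this, mul_zero]
  set w := τ.orderEmbOfFin rfl with hw
  have himg : univ.image w = τ := image_orderEmbOfFin τ rfl
  have h1 := sum_orientedCoeff_cons c (w : Fin τ.card → V)
  rw [himg, orientation_strictMono K w.strictMono, one_mul] at h1
  rw [← h1]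
  have hE : coeff (staircase w) (contraction K V (esymm V K Δ.maxCard) F) = 0 := by
    rw [he _ (by omega) le_rfl, coeff_zero]
  have hcons : ∀ v, v ∉ τ → Function.Injective (Fin.cons v w : Fin (τ.card + 1) → V) := by
    intro v hv
    rw [Fin.cons_injective_iff]
    refine ⟨?_, w.injective⟩
    rw [hw, range_orderEmbOfFin]
    simpa using hv
  have hcoeff : ∀ v ∉ τ, coeff (squarefreeExponent (insert v τ) + staircase w) F =
      orientedCoeff c (Fin.cons v w : Fin (τ.card + 1) → V) := by
    intro v hv
    -- Adding one everywhere on τ ∪ {v} gives v the exponent 1 and shifts the others to 2, …, D, so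
    -- v comes first.
    have hst : squarefreeExponent (insert v τ) + staircase w =
        staircase (Fin.cons v w : Fin (τ.card + 1) → V) := by
      rw [staircase_eq_add _ (hcons v hv), image_cons, himg, Fin.sum_univ_succ]
      simp [staircase]
    rw [hst]
    have key : ∀ (n : ℕ) (u : Fin n → V), n = Δ.maxCard → Function.Injective u →
        coeff (staircase u) F = orientedCoeff c u := by
      rintro n u rfl hu
      exact Δ.coeff_staircase_eq hF hu
    exact key _ _ hτ (hcons v hv)
  rw [coeff_contraction_esymm] at hE
  rw [← hE]
  symm
  have hzero : ∀ v ∈ τ, orientedCoeff c (Fin.cons v w : Fin (τ.card + 1) → V) = 0 := by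
    intro v hv
    refine orientedCoeff_eq_zero c fun hinj => ?_
    rw [Fin.cons_injective_iff, hw, range_orderEmbOfFin] at hinj
    exact hinj.1 hv
  rw [← sum_subset (subset_univ (univ \ τ)) fun v _ hv => hzero v (by simpa using hv)]
  have hinj : Set.InjOn (fun v => insert v τ) (univ \ τ : Finset V) := by
    intro u hu v _ huv
    have hu' : u ∉ τ := (mem_sdiff.1 (mem_coe.1 hu)).2
    have : u ∈ insert v τ := (congrArg (u ∈ ·) huv).mp (mem_insert_self u τ)
    exact (mem_insert.1 this).resolve_right hu'
  rw [← sum_congr rfl fun v hv => hcoeff v (mem_sdiff.1 hv).2,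
    ← sum_image (f := fun A => coeff (squarefreeExponent A + staircase w) F) hinj]
  symm
  refine sum_subset ?_ ?_
  · intro A hA
    obtain ⟨v, hv, rfl⟩ := mem_image.1 hA
    exact mem_powersetCard.2
      ⟨subset_univ _, by rw [card_insert_of_notMem (mem_sdiff.1 hv).2, hτ]⟩
  -- A term of F is supported on at most D vertices, while this support contains both A, of size D,
  -- and τ. Hence τ ⊆ A, that is, A = τ ∪ {v}.
  · intro A hA hA'
    refine hface _ fun hf => hA' ?_
    have hle := IsFace.card_le Δ hf
    have hAcard := (mem_powersetCard.1 hA).2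
    have hAsub : A ⊆ (squarefreeExponent A + staircase w).support := by
      intro v hv
      rw [Finsupp.mem_support_iff, Finsupp.add_apply, squarefreeExponent_apply, if_pos hv]
      omega
    have hτsub : τ ⊆ (squarefreeExponent A + staircase w).support := by
      intro v hv
      rw [← himg, ← support_staircase w.injective, Finsupp.mem_support_iff] at hv
      rw [Finsupp.mem_support_iff, Finsupp.add_apply]
      omega
    have hAeq := eq_of_subset_of_card_le hAsub (by omega)
    rw [← hAeq] at hτsub
    obtain ⟨v, hv, rfl⟩ := exists_eq_insert_iff.2 ⟨hτsub, by omega⟩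
    exact mem_image.2 ⟨v, by simpa using hv, rfl⟩

/-- The coinvariant stresses in degree `t` are the cycles of top dimension. -/
noncomputable def stressEquivCycles :
    Δ.coinvariantStresses K ((Δ.maxCard + 1).choose 2) ≃ₗ[K] Δ.cycles K Δ.dim where
  toFun F := ⟨Δ.chainOfStress F.1, Δ.chainOfStress_mem_cycles F.2⟩
  map_add' F G := by
    ext σ
    change Δ.chainOfStress (F.1 + G.1) σ = Δ.chainOfStress F.1 σ + Δ.chainOfStress G.1 σ
    unfold chainOfStress
    split_ifs
    · exact coeff_add _ _ _
    · rw [add_zero]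
  map_smul' r F := by
    ext σ
    change Δ.chainOfStress (r • F.1) σ = r * Δ.chainOfStress F.1 σ
    unfold chainOfStress
    split_ifs
    · exact coeff_smul _ _ _
    · rw [mul_zero]
  invFun c := ⟨stressOfChain Δ.maxCard c.1, Δ.stressOfChain_mem c.2⟩
  left_inv F := by
    have hc := Δ.chainOfStress_mem_cycles F.2
    have hmem := Submodule.sub_mem _ (Δ.stressOfChain_mem hc) F.2
    -- The difference is again a stress, and its staircase coefficients vanish on all sets of size
    -- D.
    refine Subtype.ext (sub_eq_zero.1 (Δ.coinvariantStress_eq_zero hmem fun σ h => ?_))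
    rw [coeff_sub, coeff_stressOfChain_staircase _ (σ.orderEmbOfFin h).injective,
      orientedCoeff_orderEmbOfFin]
    exact sub_eq_zero.2 (dif_pos h)
  right_inv c := Subtype.ext (Δ.chainOfStress_stressOfChain c.2)

/-- For every field and every complex, the space of coinvariant stresses in degree
`(dim Δ + 2).choose 2` has the dimension of the top reduced homology. -/
theorem finrank_coinvariantStresses :
    Module.finrank K (Δ.coinvariantStresses K ((Δ.maxCard + 1).choose 2)) =
      Module.finrank K (Δ.reducedHomology K Δ.dim) := by
  have hbot : (Δ.boundaries K Δ.dim).submoduleOf (Δ.cycles K Δ.dim) = ⊥ := by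
    rw [boundaries_dim, Submodule.submoduleOf, Submodule.comap_bot, Submodule.ker_subtype]
  exact (Δ.stressEquivCycles.trans (Submodule.quotEquivOfEqBot _ hbot).symm).finrank_eq

end PreAbstractSimplicialComplex

theorem mainTheorem8 (K : Type*) [Field K] (V : Type*) [Fintype V] [LinearOrder V]
    (Δ : PreAbstractSimplicialComplex V) (d : ℤ) (hd : Δ.dim = d) :
    Module.finrank K (Δ.reducedHomology K d) ≤
        Module.finrank K (Δ.coinvariantStresses K ((d + 2).toNat.choose 2)) ∧
      (CharZero K → Δ.IsCohenMacaulay K →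
        Module.finrank K (Δ.coinvariantStresses K ((d + 2).toNat.choose 2)) =
          Module.finrank K (Δ.reducedHomology K d)) := by
  subst hd
  have ht : (Δ.dim + 2).toNat = Δ.maxCard + 1 := by
    rw [PreAbstractSimplicialComplex.dim_eq]
    omega
  rw [ht]
  exact ⟨Δ.finrank_coinvariantStresses.ge, fun _ _ => Δ.finrank_coinvariantStresses⟩
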